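/- Let $n\ge 3$ be odd and let $G=SD_{8n}=\langle a,b\mid a^{4n}=b^2=1,\ bab=a^{2n-1}\rangle$ be the semi-dihedral group of order $8n$, regarded as a permutation group on $\mathbb Z/4n$ through the embedding $a\colon t\mapsto t+1$, $b\colon t\mapsto (2n-1)t$. Let $V$ be a complex inner product space of finite dimension $m$. For a character $\chi$ of $G$ let $V^{4n}_\chi(G)\subseteq\bigotimes^{4n}V$ be the symmetry class of tensors, that is, the image of $$T(G,\chi)=\frac{\chi(1)}{|G|}\sum_{\sigma\in G}\chi(\sigma)P_\sigma,\qquad P_\sigma(v_1\otimes\dots\otimes v_{4n})=v_{\sigma^{-1}(1)}\otimes\dots\otimes v_{\sigma^{-1}(4n)}.$$ Let $\chi_0,\dots,\chi_7$ be the linear characters of $G$ whose values at $(a,b)$ are, in this order, $(1,1),(1,-1),(-1,1),(-1,-1),(i,1),(i,-1),(-i,1),(-i,-1)$. With $\omega=e^{i\pi/(2n)}$, let $\rho^h$ be the two-dimensional representation of $G$ with $$\rho^h(a)=\begin{pmatrix}\omega^{h}&0\\0&\omega^{(2n-1)h}\end{pmatrix},\qquad \rho^h(b)=\begin{pmatrix}0&1\\1&0\end{pmatrix};$$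 its character is written $\varsigma_h$ if $h$ is even and $\psi_h$ if $h$ is odd. Put $$E=\{2,4,\dots,2n-2\},\qquad O=\{1,3,\dots,n-2\}\cup\{2n+1,2n+3,\dots,3n-2\},$$ and $\overline S=\{\,s(2n-1)\bmod 4n \mid s\in S\,\}$ (remainders in $\{0,\dots,4n-1\}$) for a set $S$ of integers. Then \begin{align*} \dim V^{4n}_{\chi_0}(G)&=\frac1{8n}\Big[2nm^{n}+nm^{2n}+nm^{2n+2}+\sum_{k=0}^{4n-1}m^{\gcd(4n,k)}\Big],\\ \dim V^{4n}_{\chi_1}(G)&=\frac1{8n}\Big[-2nm^{n}-nm^{2n}-nm^{2n+2}+\sum_{k=0}^{4n-1}m^{\gcd(4n,k)}\Big],\\ \dim V^{4n}_{\chi_2}(G)&=\frac1{8n}\Big[m^{4n}+m^{2n}-2m^{n}+2\sum_{k\in E}m^{\gcd(4n,k)}-\sum_{k\in O\cup\overline{O}}m^{\gcd(4n,k)}-2nm^{n}+nm^{2n}+nm^{2n+2}\Big],\\ \dim V^{4n}_{\chi_3}(G)&=\frac1{8n}\Big[m^{4n}+m^{2n}-2m^{n}+2\sum_{k\in E}m^{\gcd(4n,k)}-\sum_{k\in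 O\cup\overline{O}}m^{\gcd(4n,k)}+2nm^{n}-nm^{2n}-nm^{2n+2}\Big],\\ \dim V^{4n}_{\chi_4}(G)=\dim V^{4n}_{\chi_6}(G)&=\frac1{8n}\Big[m^{4n}-m^{2n}+\sum_{k\in E\cup\overline{E}}(-1)^{k/2}m^{\gcd(4n,k)}+nm^{2n+2}-nm^{2n}\Big],\\ \dim V^{4n}_{\chi_5}(G)=\dim V^{4n}_{\chi_7}(G)&=\frac1{8n}\Big[m^{4n}-m^{2n}+\sum_{k\in E\cup\overline{E}}(-1)^{k/2}m^{\gcd(4n,k)}-nm^{2n+2}+nm^{2n}\Big], \end{align*} for every $h\in E$ $$\dim V^{4n}_{\varsigma_h}(G)=\frac1{2n}\sum_{k=0}^{4n-1}m^{\gcd(4n,k)}\cos\Big(\frac{hk\pi}{2n}\Big),$$ and for every $h'\in O$ $$\dim V^{4n}_{\psi_{h'}}(G)=\frac1{4n}\Big[2m^{4n}-2m^{2n}+4\sum_{k\in E}m^{\gcd(4n,k)}\cos\Big(\frac{h'k\pi}{2n}\Big)\Big].$$ -/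

import Mathlib

open scoped TensorProduct

namespace SemiDihedral

/-- The two generators. -/
inductive Gen : Type
  | a : Gen
  | b : Gen

/-- The relators `a^(4n)`, `b^2` and `b a b (a^(2n-1))⁻¹` (integer exponent). -/
def rels (n : ℕ) : Set (FreeGroup Gen) :=
  {FreeGroup.of Gen.a ^ (4 * n), FreeGroup.of Gen.b ^ 2,
    FreeGroup.of Gen.b * FreeGroup.of Gen.a * FreeGroup.of Gen.b *
      (FreeGroup.of Gen.a ^ (2 * (n : ℤ) - 1))⁻¹}

/-- The semi-dihedral group `SD_{8n} = ⟨a, b ∣ a^(4n) = b^2 = 1, b a b = a^(2n-1)⟩`. -/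
abbrev SD (n : ℕ) : Type := PresentedGroup (rels n)

/-- The generator `a`. -/
def gA (n : ℕ) : SD n := PresentedGroup.of Gen.a

/-- The generator `b`. -/
def gB (n : ℕ) : SD n := PresentedGroup.of Gen.b

/-- The universal property: elements `x`, `y` of a group that satisfy the relations define the
homomorphism with `a ↦ x`, `b ↦ y`. -/
def lift (n : ℕ) {H : Type*} [Group H] (x y : H) (hx : x ^ (4 * n) = 1) (hy : y ^ 2 = 1)
    (hxy : y * x * y = x ^ (2 * (n : ℤ) - 1)) : SD n →* H :=
  PresentedGroup.toGroup (rels := rels n) (f := fun g => Gen.casesOn g x y) (by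
    intro r hr
    rcases hr with rfl | rfl | rfl
    · simpa using hx
    · simpa using hy
    · simp only [map_mul, map_inv, map_zpow, FreeGroup.lift_apply_of]
      rw [hxy, mul_inv_cancel])

theorem lift_a (n : ℕ) {H : Type*} [Group H] (x y : H) (hx : x ^ (4 * n) = 1) (hy : y ^ 2 = 1)
    (hxy : y * x * y = x ^ (2 * (n : ℤ) - 1)) : lift n x y hx hy hxy (gA n) = x := by
  simp [lift, gA]

theorem lift_b (n : ℕ) {H : Type*} [Group H] (x y : H) (hx : x ^ (4 * n) = 1) (hy : y ^ 2 = 1)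
    (hxy : y * x * y = x ^ (2 * (n : ℤ) - 1)) : lift n x y hx hy hxy (gB n) = y := by
  simp [lift, gB]

/-! ### The embedding into the symmetric group on the residues modulo `4n` -/

theorem four_mul_cast (n : ℕ) : (4 : ZMod (4 * n)) * (n : ZMod (4 * n)) = 0 := by
  have h := ZMod.natCast_self (4 * n)
  push_cast at h
  exact h

/-- `T(a)`: the permutation `t ↦ t + 1`. -/
def permA (n : ℕ) : Equiv.Perm (ZMod (4 * n)) := Equiv.addRight 1

/-- `T(b)`: the permutation `t ↦ (2n-1) t`. -/
def permB (n : ℕ) : Equiv.Perm (ZMod (4 * n)) :=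
  Function.Involutive.toPerm (fun t => (2 * (n : ZMod (4 * n)) - 1) * t) (by
    intro t
    linear_combination ((n : ZMod (4 * n)) - 1) * t * four_mul_cast n)

theorem permB_apply (n : ℕ) (t : ZMod (4 * n)) :
    permB n t = (2 * (n : ZMod (4 * n)) - 1) * t := rfl

theorem permA_apply (n : ℕ) (t : ZMod (4 * n)) : permA n t = t + 1 := rfl

theorem permA_zpow (n : ℕ) (k : ℤ) (t : ZMod (4 * n)) : (permA n ^ k) t = t + (k : ℤ) := by
  simp [permA]

/-- The homomorphism `T : SD_{8n} → S_{4n}`. -/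
def embed (n : ℕ) : SD n →* Equiv.Perm (ZMod (4 * n)) :=
  lift n (permA n) (permB n)
    (by
      refine Equiv.ext fun t => ?_
      have h := permA_zpow n ((4 * n : ℕ) : ℤ) t
      rw [zpow_natCast] at h
      rw [h]
      simp [four_mul_cast])
    (by
      refine Equiv.ext fun t => ?_
      rw [sq, Equiv.Perm.mul_apply, permB_apply, permB_apply, Equiv.Perm.one_apply]
      linear_combination ((n : ZMod (4 * n)) - 1) * t * four_mul_cast n)
    (by
      refine Equiv.ext fun t => ?_
      rw [permA_zpow, Equiv.Perm.mul_apply, Equiv.Perm.mul_apply, permB_apply, permB_apply,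
        permA_apply]
      push_cast
      linear_combination ((n : ZMod (4 * n)) - 1) * t * four_mul_cast n)

theorem embed_a (n : ℕ) : embed n (gA n) = permA n := lift_a ..

theorem embed_b (n : ℕ) : embed n (gB n) = permB n := lift_b ..

theorem gA_pow (n : ℕ) : gA n ^ (4 * n) = 1 :=
  PresentedGroup.one_of_mem (rels := rels n) (Or.inl rfl)

theorem gB_pow (n : ℕ) : gB n ^ 2 = 1 :=
  PresentedGroup.one_of_mem (rels := rels n) (Or.inr (Or.inl rfl))

theorem gB_gA_gB (n : ℕ) : gB n * gA n * gB n = gA n ^ (2 * (n : ℤ) - 1) :=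
  mul_inv_eq_one.mp (PresentedGroup.one_of_mem (rels := rels n) (Or.inr (Or.inr rfl)))

/-- Every element is of the form `a^i` or `a^i b`. -/
theorem exists_normal_form (n : ℕ) (g : SD n) :
    ∃ i : ℤ, g = gA n ^ i ∨ g = gA n ^ i * gB n := by
  have hb : gB n * gB n = 1 := by rw [← sq, gB_pow]
  have hbi : (gB n)⁻¹ = gB n := inv_eq_of_mul_eq_one_left hb
  have hba : gB n * gA n = gA n ^ (2 * (n : ℤ) - 1) * gB n := by
    rw [← gB_gA_gB, mul_assoc _ (gB n), hb, mul_one]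
  have hbai : gB n * (gA n)⁻¹ = gA n ^ (-(2 * (n : ℤ) - 1)) * gB n := by
    rw [zpow_neg, ← gB_gA_gB]
    simp [mul_assoc, hbi, hb]
  have hg : g ∈ Subgroup.closure (Set.range (PresentedGroup.of (rels := rels n))) := by
    rw [PresentedGroup.closure_range_of]; trivial
  induction hg using Subgroup.closure_induction_right with
  | one => exact ⟨0, Or.inl (by simp)⟩
  | mul_right x _ y hy ih =>
    obtain ⟨i, rfl | rfl⟩ := ih
    · rcases hy with ⟨_ | _, rfl⟩
      · exact ⟨i + 1, Or.inl (zpow_add_one (gA n) i).symm⟩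
      · exact ⟨i, Or.inr rfl⟩
    · rcases hy with ⟨_ | _, rfl⟩
      · exact ⟨i + (2 * (n : ℤ) - 1), Or.inr (by
          change gA n ^ i * gB n * gA n = _
          rw [mul_assoc, hba, zpow_add, mul_assoc])⟩
      · exact ⟨i, Or.inl (by
          change gA n ^ i * gB n * gB n = _
          rw [mul_assoc, hb, mul_one])⟩
  | mul_inv_cancel x _ y hy ih =>
    obtain ⟨i, rfl | rfl⟩ := ih
    · rcases hy with ⟨_ | _, rfl⟩
      · exact ⟨i - 1, Or.inl (zpow_sub_one (gA n) i).symm⟩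
      · exact ⟨i, Or.inr (by
          change gA n ^ i * (gB n)⁻¹ = _
          rw [hbi])⟩
    · rcases hy with ⟨_ | _, rfl⟩
      · exact ⟨i + -(2 * (n : ℤ) - 1), Or.inr (by
          change gA n ^ i * gB n * (gA n)⁻¹ = _
          rw [mul_assoc, hbai, zpow_add, mul_assoc])⟩
      · exact ⟨i, Or.inl (by
          change gA n ^ i * gB n * (gB n)⁻¹ = _
          rw [mul_inv_cancel_right])⟩

/-- For `n ≥ 2` the homomorphism `T` is injective, so that `SD_{8n}` is a permutation group. -/
theorem embed_injective (n : ℕ) (hn : 2 ≤ n) : Function.Injective (embed n) := by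
  rw [injective_iff_map_eq_one]
  intro g hg
  have key : ∀ i : ℤ, (i : ZMod (4 * n)) = 0 → gA n ^ i = 1 := by
    intro i hi
    obtain ⟨k, rfl⟩ := (ZMod.intCast_zmod_eq_zero_iff_dvd i (4 * n)).mp hi
    rw [zpow_mul, zpow_natCast, gA_pow, one_zpow]
  obtain ⟨i, rfl | rfl⟩ := exists_normal_form n g
  · have h := congrArg (fun s : Equiv.Perm (ZMod (4 * n)) => s 0) hg
    simp only [map_zpow, embed_a, permA_zpow, Equiv.Perm.one_apply, zero_add] at h
    exact key i h
  · have h := congrArg (fun s : Equiv.Perm (ZMod (4 * n)) => s 0) hg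
    simp only [map_mul, map_zpow, embed_a, embed_b, Equiv.Perm.mul_apply, permB_apply, permA_zpow,
      Equiv.Perm.one_apply, mul_zero, zero_add] at h
    rw [key i h, one_mul, embed_b] at hg
    have h1 := congrArg (fun s : Equiv.Perm (ZMod (4 * n)) => s 1) hg
    simp only [permB_apply, Equiv.Perm.one_apply, mul_one] at h1
    have h2 : ((2 * n - 2 : ℕ) : ZMod (4 * n)) = 0 := by
      rw [Nat.cast_sub (by omega)]
      push_cast
      linear_combination h1
    have h3 := Nat.le_of_dvd (by omega) ((ZMod.natCast_eq_zero_iff _ _).mp h2)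
    omega

theorem finite_SD (n : ℕ) (hn : 2 ≤ n) : Finite (SD n) := by
  have : NeZero (4 * n) := ⟨by omega⟩
  exact Finite.of_injective _ (embed_injective n hn)

/-! ### The characters -/

/-- For odd `n`, the linear character with `a ↦ α`, `b ↦ β`, where `α^4 = β^2 = 1`. -/
def linChar (n : ℕ) (hn : Odd n) (α β : ℂˣ) (hα : α ^ 4 = 1) (hβ : β ^ 2 = 1) : SD n → ℂ :=
  fun g => (lift n α β (by rw [pow_mul, hα, one_pow]) hβ (by
    obtain ⟨k, rfl⟩ := hn
    have h1 : (2 * ((2 * k + 1 : ℕ) : ℤ) - 1) = ((4 * k + 1 : ℕ) : ℤ) := by push_cast; ring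
    rw [h1, zpow_natCast, pow_succ, pow_mul, hα, one_pow, one_mul, mul_right_comm, ← sq, hβ,
      one_mul]) g : ℂˣ)

/-- The imaginary unit as a unit of `ℂ`. -/
noncomputable def unitI : ℂˣ := Units.mk0 Complex.I Complex.I_ne_zero

theorem unitI_pow : unitI ^ 4 = 1 := by
  ext; simp [unitI]

theorem neg_unitI_pow : (-unitI) ^ 4 = 1 := by
  rw [Even.neg_pow (by decide), unitI_pow]

theorem neg_one_pow_four : (-1 : ℂˣ) ^ 4 = 1 := by simp [Even.neg_pow (by decide : Even 4)]

theorem neg_one_pow_two : (-1 : ℂˣ) ^ 2 = 1 := by simp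

/-- `a ↦ 1`, `b ↦ 1`. -/
def chi0 (n : ℕ) (hn : Odd n) : SD n → ℂ :=
  linChar n hn 1 1 (one_pow 4) (one_pow 2)

/-- `a ↦ 1`, `b ↦ -1`. -/
def chi1 (n : ℕ) (hn : Odd n) : SD n → ℂ :=
  linChar n hn 1 (-1) (one_pow 4) neg_one_pow_two

/-- `a ↦ -1`, `b ↦ 1`. -/
def chi2 (n : ℕ) (hn : Odd n) : SD n → ℂ :=
  linChar n hn (-1) 1 neg_one_pow_four (one_pow 2)

/-- `a ↦ -1`, `b ↦ -1`. -/
def chi3 (n : ℕ) (hn : Odd n) : SD n → ℂ :=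
  linChar n hn (-1) (-1) neg_one_pow_four neg_one_pow_two

/-- `a ↦ i`, `b ↦ 1`. -/
noncomputable def chi4 (n : ℕ) (hn : Odd n) : SD n → ℂ :=
  linChar n hn unitI 1 unitI_pow (one_pow 2)

/-- `a ↦ i`, `b ↦ -1`. -/
noncomputable def chi5 (n : ℕ) (hn : Odd n) : SD n → ℂ :=
  linChar n hn unitI (-1) unitI_pow neg_one_pow_two

/-- `a ↦ -i`, `b ↦ 1`. -/
noncomputable def chi6 (n : ℕ) (hn : Odd n) : SD n → ℂ :=
  linChar n hn (-unitI) 1 neg_unitI_pow (one_pow 2)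

/-- `a ↦ -i`, `b ↦ -1`. -/
noncomputable def chi7 (n : ℕ) (hn : Odd n) : SD n → ℂ :=
  linChar n hn (-unitI) (-1) neg_unitI_pow neg_one_pow_two

/-- `ω = e^{iπ/(2n)}`. -/
noncomputable def omega (n : ℕ) : ℂ := Complex.exp (Complex.I * Real.pi / (2 * n))

theorem omega_ne_zero (n : ℕ) : omega n ≠ 0 := Complex.exp_ne_zero _

theorem omega_zpow (n : ℕ) (k : ℤ) : omega n ^ (4 * (n : ℤ) * k) = 1 := by
  rcases Nat.eq_zero_or_pos n with rfl | h
  · simp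
  · have h0 : (n : ℂ) ≠ 0 := by exact_mod_cast h.ne'
    rw [zpow_mul]
    have : omega n ^ (4 * (n : ℤ)) = 1 := by
      rw [omega, ← Complex.exp_int_mul, ← Complex.exp_two_pi_mul_I]
      congr 1
      push_cast
      field_simp
      ring
    rw [this, one_zpow]

theorem omega_pow (n : ℕ) : omega n ^ (4 * n) = 1 := by
  have h := omega_zpow n 1
  rw [mul_one] at h
  exact_mod_cast h

/-- `ω` as a unit of `ℂ`. -/
noncomputable def omegaU (n : ℕ) : ℂˣ := Units.mk0 (omega n) (omega_ne_zero n)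

theorem omegaU_zpow (n : ℕ) (k : ℤ) : omegaU n ^ (4 * (n : ℤ) * k) = 1 := by
  ext
  simpa [omegaU] using omega_zpow n k

/-- The invertible diagonal matrix `diag(x, y)`. -/
noncomputable def diagU (x y : ℂˣ) : GL (Fin 2) ℂ where
  val := !![(x : ℂ), 0; 0, (y : ℂ)]
  inv := !![((x⁻¹ : ℂˣ) : ℂ), 0; 0, ((y⁻¹ : ℂˣ) : ℂ)]
  val_inv := by simp [Matrix.one_fin_two]
  inv_val := by simp [Matrix.one_fin_two]

theorem diagU_mul (x y x' y' : ℂˣ) : diagU x y * diagU x' y' = diagU (x * x') (y * y') := by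
  apply Units.ext
  simp [diagU]

theorem diagU_one : diagU 1 1 = 1 := by
  apply Units.ext
  simp [diagU, Matrix.one_fin_two]

theorem diagU_zpow (x y : ℂˣ) (k : ℤ) : diagU x y ^ k = diagU (x ^ k) (y ^ k) := by
  let f : ℂˣ × ℂˣ →* GL (Fin 2) ℂ :=
    { toFun := fun p => diagU p.1 p.2
      map_one' := diagU_one
      map_mul' := fun p q => (diagU_mul p.1 p.2 q.1 q.2).symm }
  exact (map_zpow f (x, y) k).symm

/-- The invertible matrix that exchanges the two basis vectors. -/
def swapU : GL (Fin 2) ℂ where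
  val := !![0, 1; 1, 0]
  inv := !![0, 1; 1, 0]
  val_inv := by simp [Matrix.one_fin_two]
  inv_val := by simp [Matrix.one_fin_two]

theorem swapU_sq : swapU ^ 2 = 1 := by
  apply Units.ext
  simp [swapU, sq, Matrix.one_fin_two]

theorem swapU_conj (x y : ℂˣ) : swapU * diagU x y * swapU = diagU y x := by
  apply Units.ext
  simp [swapU, diagU]

/-- The two-dimensional representation `ρ^h` of `SD_{8n}`, with
`ρ^h(a) = diag(ω^h, ω^{(2n-1)h})` and `ρ^h(b)` the exchange matrix. -/
noncomputable def rho (n h : ℕ) : SD n →* GL (Fin 2) ℂ :=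
  lift n (diagU (omegaU n ^ (h : ℤ)) (omegaU n ^ ((2 * (n : ℤ) - 1) * h))) swapU
    (by
      rw [← zpow_natCast, diagU_zpow, ← zpow_mul, ← zpow_mul, ← diagU_one]
      push_cast
      congr 1
      · rw [mul_comm, omegaU_zpow]
      · rw [mul_comm, omegaU_zpow])
    swapU_sq
    (by
      rw [swapU_conj, diagU_zpow, ← zpow_mul, ← zpow_mul]
      congr 1
      · rw [mul_comm]
      · have : (2 * (n : ℤ) - 1) * h * (2 * (n : ℤ) - 1)
            = h + 4 * (n : ℤ) * ((n - 1) * h) := by ring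
        rw [this, zpow_add, omegaU_zpow, mul_one])

/-- The character of `ρ^h`. It is written `ς_h` for even `h` and `ψ_h` for odd `h`. -/
noncomputable def rhoChar (n h : ℕ) : SD n → ℂ :=
  fun g => Matrix.trace ((rho n h g : GL (Fin 2) ℂ) : Matrix (Fin 2) (Fin 2) ℂ)

/-- On `a^r` the character of `ρ^h` has the value `ω^{hr} + ω^{(2n-1)hr}`. -/
theorem rhoChar_a_zpow (n h : ℕ) (r : ℤ) : rhoChar n h (gA n ^ r) =
    omega n ^ ((h : ℤ) * r) + omega n ^ ((2 * (n : ℤ) - 1) * h * r) := by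
  rw [rhoChar, map_zpow, rho, lift_a, diagU_zpow, ← zpow_mul, ← zpow_mul]
  simp [diagU, Matrix.trace_fin_two, omegaU]

/-- The character of `ρ^h` vanishes on `a^r b`. -/
theorem rhoChar_a_zpow_b (n h : ℕ) (r : ℤ) : rhoChar n h (gA n ^ r * gB n) = 0 := by
  rw [rhoChar, map_mul, map_zpow, rho, lift_a, lift_b, diagU_zpow]
  simp [diagU, swapU, Matrix.trace_fin_two]

/-! ### Symmetry classes of tensors -/

/-- The operator `P_σ` on `⨂ V`, with
`P_σ (⨂ₜ i, v i) = ⨂ₜ i, v (σ⁻¹ i)`. -/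
noncomputable def permOp {ι : Type*} (V : Type*) [AddCommGroup V] [Module ℂ V]
    (σ : Equiv.Perm ι) : (⨂[ℂ] _ : ι, V) →ₗ[ℂ] (⨂[ℂ] _ : ι, V) :=
  (PiTensorProduct.reindex ℂ (fun _ : ι => V) σ).toLinearMap

theorem permOp_tprod {ι : Type*} (V : Type*) [AddCommGroup V] [Module ℂ V]
    (σ : Equiv.Perm ι) (v : ι → V) :
    permOp V σ (PiTensorProduct.tprod ℂ v) = PiTensorProduct.tprod ℂ (fun i => v (σ⁻¹ i)) :=
  PiTensorProduct.reindex_tprod σ v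

/-- The symmetry operator `T(G,χ) = (χ(1)/|G|) ∑_{g ∈ G} χ(g) P_g`, for a finite group `G` that
acts on the positions `ι` through `φ`. -/
noncomputable def symmetrizer {G : Type*} [Group G] {ι : Type*} (φ : G →* Equiv.Perm ι)
    (χ : G → ℂ) (V : Type*) [AddCommGroup V] [Module ℂ V] :
    (⨂[ℂ] _ : ι, V) →ₗ[ℂ] (⨂[ℂ] _ : ι, V) :=
  (χ 1 / (Nat.card G : ℂ)) • ∑ᶠ g : G, χ g • permOp V (φ g)

/-- The symmetry class of tensors: the image of the symmetry operator. -/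
noncomputable def symmetryClass {G : Type*} [Group G] {ι : Type*} (φ : G →* Equiv.Perm ι)
    (χ : G → ℂ) (V : Type*) [AddCommGroup V] [Module ℂ V] : Submodule ℂ (⨂[ℂ] _ : ι, V) :=
  LinearMap.range (symmetrizer φ χ V)

/-- `dim V^{4n}_χ(SD_{8n})`. -/
noncomputable def dimClass (n : ℕ) (V : Type*) [AddCommGroup V] [Module ℂ V] (χ : SD n → ℂ) : ℕ :=
  Module.finrank ℂ (symmetryClass (embed n) χ V)

/-! ### The index sets -/

/-- `{0, 2, 4, …, 2n}`. -/
def C1 (n : ℕ) : Finset ℕ := {k ∈ Finset.Icc 0 (2 * n) | Even k}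

/-- `{2, 4, …, 2n-2}`. -/
def CdagEven (n : ℕ) : Finset ℕ := C1 n \ {0, 2 * n}

/-- For odd `n`: `{1, 3, …, n} ∪ {2n+1, 2n+3, …, 3n}`. -/
def Codd23 (n : ℕ) : Finset ℕ :=
  {k ∈ Finset.Icc 1 n ∪ Finset.Icc (2 * n + 1) (3 * n) | Odd k}

/-- The odd numbers in `[1, n-1] ∪ [2n+1, 3n-1]`. -/
def CdagOdd (n : ℕ) : Finset ℕ :=
  {k ∈ Finset.Icc 1 (n - 1) ∪ Finset.Icc (2 * n + 1) (3 * n - 1) | Odd k}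

/-- `S ↦ {s (2n-1) mod 4n ∣ s ∈ S}`. -/
def bar (n : ℕ) (S : Finset ℕ) : Finset ℕ := S.image (fun s => s * (2 * n - 1) % (4 * n))

end SemiDihedral

/-!
An irreducible character satisfies `χ * χ = (|G| / χ(1)) χ`, so `T(G, χ)` is idempotent and the
dimension of its image is its trace. Since `P_σ` permutes a basis of the tensor power indexed by
functions, its trace counts the functions constant on the orbits of `σ`, whence
`dim V_χ(G) = χ(1)/|G| · ∑ χ(σ) m^c(σ)` with `c(σ)` the number of orbits of `σ`.

The translation `a^k` has `gcd(4n, k)` orbits on `ℤ/4n`. By Burnside's lemma for the cyclic group it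
generates, `a^k b` has `2n + 2`, `n`, `2n`, `n` orbits for `k ≡ 0, 1, 2, 3` modulo `4`: it is an
involution with four or no fixed points if `k` is even, and a free element of order four if `k` is
odd. What remains is to rewrite the sums over `a^k` in terms of the given index sets, mostly by
pairing `k` with `4n - k`.
-/

namespace SemiDihedral

/-! ### Orbits of a permutation -/

/-- The number of orbits (cycles, counting fixed points) of a permutation, written `c(σ)` in the
literature on symmetry classes. It is `0` by convention if there are infinitely many. -/
noncomputable def orbitCount {ι : Type*} (σ : Equiv.Perm ι) : ℕ :=
  Nat.card (Quotient (Equiv.Perm.SameCycle.setoid σ))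

theorem sameCycle_setoid_le_ker_iff {ι κ : Type*} (σ : Equiv.Perm ι) (f : ι → κ) :
    Equiv.Perm.SameCycle.setoid σ ≤ Setoid.ker f ↔ ∀ i, f (σ i) = f i := by
  refine ⟨fun h i => (h (Equiv.Perm.SameCycle.refl σ i).apply_right).symm, ?_⟩
  rintro h i _ ⟨k, rfl⟩
  change f i = f ((σ ^ k) i)
  induction k with
  | zero => rfl
  | succ k ih => rw [add_comm, zpow_one_add, Equiv.Perm.mul_apply, h, ih]
  | pred k ih =>
    rw [ih, ← h ((σ ^ (-(k : ℤ) - 1)) i), ← Equiv.Perm.mul_apply, ← zpow_one_add, add_sub_cancel]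

theorem card_invariant_functions {ι : Type*} [Finite ι] (κ : Type*) (σ : Equiv.Perm ι) :
    Nat.card {f : ι → κ // ∀ i, f (σ i) = f i} = Nat.card κ ^ orbitCount σ := by
  rw [orbitCount, ← Nat.card_fun]
  exact Nat.card_congr <|
    (Equiv.subtypeEquivRight fun f => (sameCycle_setoid_le_ker_iff σ f).symm).trans
      (Setoid.liftEquiv (Equiv.Perm.SameCycle.setoid σ))

theorem orbitCount_addRight {A : Type*} [AddGroup A] (a : A) :
    orbitCount (Equiv.addRight a) = (AddSubgroup.zmultiples a).index := by
  refine Nat.card_congr (Quotient.congr (Equiv.refl A) fun x y => ?_)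
  change (∃ k : ℤ, (Equiv.addRight a ^ k) x = y) ↔ QuotientAddGroup.leftRel _ x y
  simp only [QuotientAddGroup.leftRel_apply, AddSubgroup.mem_zmultiples_iff, eq_neg_add_iff_add_eq,
    Equiv.zsmul_addRight, Equiv.coe_addRight]

theorem index_zmultiples_natCast {N : ℕ} [NeZero N] (k : ℕ) :
    (AddSubgroup.zmultiples (k : ZMod N)).index = N.gcd k := by
  have hgcd : 0 < N.gcd k := Nat.gcd_pos_of_pos_left k (NeZero.pos N)
  have hdvd : N.gcd k ∣ N := Nat.gcd_dvd_left N k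
  have h := (AddSubgroup.zmultiples (k : ZMod N)).card_mul_index
  rw [Nat.card_zmultiples, ZMod.addOrderOf_coe k (NeZero.ne N), Nat.card_zmod] at h
  refine Nat.eq_of_mul_eq_mul_left (Nat.div_pos (Nat.le_of_dvd (NeZero.pos N) hdvd) hgcd) ?_
  rw [h, Nat.div_mul_cancel hdvd]

theorem sum_range_mul_of_periodic {M : Type*} [AddCommMonoid M] {f : ℕ → M} {c : ℕ}
    (hf : Function.Periodic f c) (n : ℕ) :
    ∑ k ∈ Finset.range (c * n), f k = n • ∑ k ∈ Finset.range c, f k := by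
  induction n with
  | zero => simp
  | succ n ih =>
    rw [mul_add_one, Finset.sum_range_add, ih, succ_nsmul]
    congr 1
    refine Finset.sum_congr rfl fun k _ => ?_
    rw [add_comm, mul_comm]
    exact hf.nat_mul n k

theorem sum_card_fixedPoints_orderOf {ι : Type*} [Fintype ι] [DecidableEq ι]
    (σ : Equiv.Perm ι) :
    ∑ i ∈ Finset.range (orderOf σ), Finset.card {t | (σ ^ i) t = t} =
      orbitCount σ * orderOf σ := by
  classical
  have horbits : Fintype.card (MulAction.orbitRel.Quotient (Subgroup.zpowers σ) ι) =
      orbitCount σ := by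
    rw [orbitCount, ← Nat.card_eq_fintype_card]
    refine Nat.card_congr (Quotient.congr (Equiv.refl ι) fun x y => ?_)
    change x ∈ MulAction.orbit _ y ↔ σ.SameCycle x y
    rw [Equiv.Perm.sameCycle_comm]
    exact Subgroup.exists_zpowers (p := fun g => g • y = x)
  rw [← horbits, ← Fintype.card_zpowers,
    ← MulAction.sum_card_fixedBy_eq_card_orbits_mul_card_group, Fintype.card_zpowers,
    Finset.sum_range]
  refine Fintype.sum_equiv (finEquivZPowers (isOfFinOrder_of_finite σ)) _ _ fun i => ?_
  rw [Fintype.card_subtype]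
  rfl

/-- Burnside's lemma for the group generated by `σ`, where `d` may be a multiple of the order. -/
theorem sum_card_fixedPoints {ι : Type*} [Fintype ι] [DecidableEq ι] {σ : Equiv.Perm ι} {d : ℕ}
    (hd : σ ^ d = 1) :
    ∑ i ∈ Finset.range d, Finset.card {t | (σ ^ i) t = t} = orbitCount σ * d := by
  obtain ⟨e, rfl⟩ := orderOf_dvd_of_pow_eq_one hd
  have hper : Function.Periodic (fun i => Finset.card {t | (σ ^ i) t = t}) (orderOf σ) := by
    intro i
    simp only [pow_add, pow_orderOf_eq_one, mul_one]
  rw [sum_range_mul_of_periodic hper, sum_card_fixedPoints_orderOf, smul_eq_mul]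
  ring

/-! ### Dimensions of symmetry classes -/

/-- The convolution identity `χ(1) · (χ * χ) = |G| · χ` of an irreducible character: it says that
`χ(1)/|G| · ∑ χ(g) g` is an idempotent of the group algebra. -/
def IsConvIdempotent {G : Type*} [Group G] (χ : G → ℂ) : Prop :=
  ∀ g, χ 1 * ∑ᶠ x, χ x * χ (x⁻¹ * g) = Nat.card G * χ g

theorem permOp_mul {ι : Type*} (V : Type*) [AddCommGroup V] [Module ℂ V] (σ τ : Equiv.Perm ι) :
    permOp V (σ * τ) = permOp V σ * permOp V τ := by
  refine PiTensorProduct.ext (MultilinearMap.ext fun v => ?_)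
  simp [permOp_tprod]

section Symmetrizer

variable {G : Type*} [Group G] {ι : Type*} (φ : G →* Equiv.Perm ι) {χ : G → ℂ}
  (V : Type*) [AddCommGroup V] [Module ℂ V]

theorem sum_smul_permOp_mul_self [Fintype G] :
    (∑ x, χ x • permOp V (φ x)) * (∑ y, χ y • permOp V (φ y)) =
      ∑ g, (∑ x, χ x * χ (x⁻¹ * g)) • permOp V (φ g) := by
  simp_rw [Finset.sum_mul_sum, Finset.sum_smul]
  rw [Finset.sum_comm (f := fun g x => (χ x * χ (x⁻¹ * g)) • permOp V (φ g))]
  refine Finset.sum_congr rfl fun x _ => Fintype.sum_equiv (Equiv.mulLeft x) _ _ fun y => ?_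
  simp [permOp_mul, smul_smul, mul_comm]

theorem IsConvIdempotent.isIdempotentElem_symmetrizer [Finite G] (hχ : IsConvIdempotent χ) :
    IsIdempotentElem (symmetrizer φ χ V) := by
  have := Fintype.ofFinite G
  have hG : (Nat.card G : ℂ) ≠ 0 := by exact_mod_cast Nat.card_pos.ne'
  rw [IsIdempotentElem, symmetrizer, finsum_eq_sum_of_fintype, smul_mul_smul_comm,
    sum_smul_permOp_mul_self, Finset.smul_sum, Finset.smul_sum]
  refine Finset.sum_congr rfl fun g _ => ?_
  have hconv := hχ g
  rw [finsum_eq_sum_of_fintype] at hconv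
  rw [smul_smul, smul_smul]
  congr 1
  field_simp
  linear_combination χ 1 * hconv

theorem trace_permOp [Finite ι] [FiniteDimensional ℂ V] (σ : Equiv.Perm ι) :
    LinearMap.trace ℂ _ (permOp V σ) = (Module.finrank ℂ V : ℂ) ^ orbitCount σ := by
  classical
  have := Fintype.ofFinite ι
  let b := Basis.piTensorProduct fun _ : ι => Module.finBasis ℂ V
  have hdiag : ∀ f : ι → Fin (Module.finrank ℂ V), LinearMap.toMatrix b b (permOp V σ) f f =
      if ∀ i, f (σ i) = f i then 1 else 0 := by
    intro f
    have hinv : (∀ i, f (σ⁻¹ i) = f i) ↔ ∀ i, f (σ i) = f i :=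
      ⟨fun h i => by simpa using (h (σ i)).symm, fun h i => by simpa using (h (σ⁻¹ i)).symm⟩
    rw [LinearMap.toMatrix_apply, Basis.piTensorProduct_apply, permOp_tprod,
      Basis.piTensorProduct_repr_tprod_apply]
    simp only [Module.Basis.repr_self, Finsupp.single_apply, Fintype.prod_ite_zero, hinv,
      Finset.prod_const_one]
  have hcard := card_invariant_functions (Fin (Module.finrank ℂ V)) σ
  rw [Nat.card_fin, Nat.card_eq_fintype_card, Fintype.card_subtype] at hcard
  rw [LinearMap.trace_eq_matrix_trace ℂ b, Matrix.trace, ← Nat.cast_pow, ← hcard]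
  simp only [Matrix.diag_apply, hdiag, Finset.sum_boole]

theorem IsConvIdempotent.finrank_symmetryClass [Finite G] [Finite ι] [FiniteDimensional ℂ V]
    (hχ : IsConvIdempotent χ) :
    (Module.finrank ℂ (symmetryClass φ χ V) : ℂ) =
      χ 1 / Nat.card G * ∑ᶠ g, χ g * (Module.finrank ℂ V : ℂ) ^ orbitCount (φ g) := by
  have := Fintype.ofFinite G
  have : FiniteDimensional ℂ (⨂[ℂ] _ : ι, V) :=
    Module.Finite.of_basis (Basis.piTensorProduct fun _ => Module.finBasis ℂ V)
  have hproj := LinearMap.IsIdempotentElem.isProj_range _ (hχ.isIdempotentElem_symmetrizer φ V)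
  rw [symmetryClass, ← hproj.trace, symmetrizer, finsum_eq_sum_of_fintype,
    finsum_eq_sum_of_fintype]
  simp only [map_smul, map_sum, trace_permOp, smul_eq_mul]

end Symmetrizer

/-! ### The elements of the semi-dihedral group -/

theorem embed_gA_pow (n k : ℕ) : embed n (gA n ^ k) = Equiv.addRight (k : ZMod (4 * n)) := by
  ext t
  rw [map_pow, embed_a, ← zpow_natCast, permA_zpow, Equiv.coe_addRight, Int.cast_natCast]

theorem embed_gA_pow_mul_gB_apply (n k : ℕ) (t : ZMod (4 * n)) :
    embed n (gA n ^ k * gB n) t = (2 * (n : ZMod (4 * n)) - 1) * t + k := by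
  rw [map_mul, Equiv.Perm.mul_apply, embed_gA_pow, Equiv.coe_addRight, embed_b, permB_apply]

theorem gA_pow_mul_gB_ne_gA_pow (n i j : ℕ) : gA n ^ i * gB n ≠ gA n ^ j := by
  intro h
  let f : SD n →* ℤˣ := lift n 1 (-1) (one_pow _) (by decide) (by rw [one_zpow]; decide)
  have hf := congrArg f h
  rw [map_mul, map_pow, map_pow, lift_a, lift_b, one_pow, one_pow, one_mul] at hf
  exact absurd hf (by decide)

theorem gA_pow_injective (n : ℕ) : Function.Injective fun i : Fin (4 * n) => gA n ^ (i : ℕ) := by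
  intro i j h
  have h0 := congrArg (fun g => embed n g 0) h
  simp only [embed_gA_pow, Equiv.coe_addRight, zero_add] at h0
  exact Fin.ext (((ZMod.natCast_eq_natCast_iff _ _ _).mp h0).eq_of_lt_of_lt i.2 j.2)

theorem exists_gA_pow_eq_zpow (n : ℕ) [NeZero n] (k : ℤ) :
    ∃ i : Fin (4 * n), gA n ^ (i : ℕ) = gA n ^ k := by
  have hpos : (0 : ℤ) < (4 * n : ℕ) := by exact_mod_cast NeZero.pos (4 * n)
  have hnonneg := Int.emod_nonneg k hpos.ne'
  have hlt := Int.emod_lt_of_pos k hpos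
  refine ⟨⟨(k % (4 * n : ℕ)).toNat, by omega⟩, ?_⟩
  rw [← zpow_natCast, Int.toNat_of_nonneg hnonneg, ← zpow_eq_zpow_emod _ (gA_pow n)]

theorem bijective_normal_form (n : ℕ) [NeZero n] : Function.Bijective
    (Sum.elim (fun i : Fin (4 * n) => gA n ^ (i : ℕ))
      fun i : Fin (4 * n) => gA n ^ (i : ℕ) * gB n) := by
  refine ⟨(gA_pow_injective n).sumElim ((mul_left_injective _).comp (gA_pow_injective n))
    fun i j => (gA_pow_mul_gB_ne_gA_pow n j i).symm, fun g => ?_⟩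
  obtain ⟨k, rfl | rfl⟩ := exists_normal_form n g <;>
    obtain ⟨i, hi⟩ := exists_gA_pow_eq_zpow n k
  · exact ⟨Sum.inl i, hi⟩
  · exact ⟨Sum.inr i, congrArg (· * gB n) hi⟩

instance instFiniteSD (n : ℕ) [NeZero n] : Finite (SD n) :=
  Finite.of_surjective _ (bijective_normal_form n).surjective

theorem card_SD (n : ℕ) [NeZero n] : Nat.card (SD n) = 8 * n := by
  rw [← Nat.card_eq_of_bijective _ (bijective_normal_form n), Nat.card_sum, Nat.card_fin]
  ring

theorem finsum_SD (n : ℕ) [NeZero n] {M : Type*} [AddCommMonoid M] (F : SD n → M) :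
    ∑ᶠ g, F g = ∑ i ∈ Finset.range (4 * n), F (gA n ^ i) +
      ∑ i ∈ Finset.range (4 * n), F (gA n ^ i * gB n) := by
  rw [← finsum_comp _ (bijective_normal_form n), finsum_eq_sum_of_fintype, Fintype.sum_sum_type,
    Finset.sum_range, Finset.sum_range]
  rfl

/-! ### Orbits on the residues modulo `4n` -/

theorem orbitCount_embed_gA_pow (n k : ℕ) [NeZero n] :
    orbitCount (embed n (gA n ^ k)) = (4 * n).gcd k := by
  rw [embed_gA_pow, orbitCount_addRight, index_zmultiples_natCast]

theorem embed_gA_pow_mul_gB_sq (n k : ℕ) :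
    embed n (gA n ^ k * gB n) ^ 2 = Equiv.addRight ((2 * n * k : ℕ) : ZMod (4 * n)) := by
  ext t
  rw [sq, Equiv.Perm.mul_apply, embed_gA_pow_mul_gB_apply, embed_gA_pow_mul_gB_apply,
    Equiv.coe_addRight]
  push_cast
  linear_combination ((n : ZMod (4 * n)) - 1) * t * four_mul_cast n

theorem embed_gA_pow_mul_gB_natCast_eq_iff (n k i : ℕ) [NeZero n] :
    embed n (gA n ^ k * gB n) (i : ZMod (4 * n)) = i ↔ 4 * n ∣ 2 * (n - 1) * i + k := by
  rw [embed_gA_pow_mul_gB_apply, ← ZMod.natCast_eq_zero_iff, ← sub_eq_zero]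
  push_cast [Nat.cast_sub (NeZero.one_le (n := n))]
  constructor <;> intro h <;> linear_combination h

theorem four_mul_dvd_iff_modEq {n : ℕ} (hn : Odd n) (s i : ℕ) :
    4 * n ∣ 2 * (n - 1) * i + 4 * s ↔ i ≡ 2 * s [MOD n] := by
  obtain ⟨j, rfl⟩ := hn
  rw [show 2 * (2 * j + 1 - 1) * i + 4 * s = 4 * (j * i + s) by rw [Nat.add_sub_cancel]; ring,
    Nat.mul_dvd_mul_iff_left (by norm_num), ← Int.natCast_dvd_natCast, ← Int.natCast_modEq_iff,
    Int.modEq_iff_dvd]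
  push_cast
  constructor
  · rintro ⟨c, hc⟩
    exact ⟨2 * c - i, by linear_combination 2 * hc⟩
  · rintro ⟨c, hc⟩
    exact ⟨s - j * c, by linear_combination (-(j : ℤ)) * hc⟩

theorem card_filter_zmod (N : ℕ) [NeZero N] (p : ZMod N → Prop) [DecidablePred p] :
    Finset.card {t | p t} = Finset.card {i ∈ Finset.range N | p (i : ℕ)} := by
  refine Finset.card_nbij' ZMod.val (fun i => (i : ZMod N)) ?_ ?_ ?_ ?_
  · intro t ht
    simpa [ZMod.val_lt] using ht
  · intro i hi
    simpa using (Finset.mem_filter.mp hi).2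
  · simp [Set.LeftInvOn]
  · intro i hi
    exact ZMod.val_cast_of_lt (Finset.mem_range.mp (Finset.mem_filter.mp hi).1)

theorem card_fixed_embed_gA_pow_mul_gB {n : ℕ} (hn : Odd n) [NeZero n] (k : ℕ) :
    Finset.card {t | embed n (gA n ^ k * gB n) t = t} = if 4 ∣ k then 4 else 0 := by
  simp_rw [card_filter_zmod, embed_gA_pow_mul_gB_natCast_eq_iff]
  split_ifs with hk
  · obtain ⟨s, rfl⟩ := hk
    simp_rw [four_mul_dvd_iff_modEq hn]
    rw [← Nat.count_eq_card_filter_range, Nat.count_modEq_card _ (NeZero.pos n),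
      Nat.mul_div_cancel _ (NeZero.pos n), Nat.mul_mod_left, if_neg (Nat.not_lt_zero _)]
  · rw [Finset.card_eq_zero, Finset.filter_eq_empty_iff]
    intro i _ h
    obtain ⟨j, rfl⟩ := hn
    have h4 : 4 ∣ 4 * (j * i) + k := by
      refine (Dvd.intro _ rfl).trans (h.trans (dvd_of_eq ?_))
      rw [Nat.add_sub_cancel]
      ring
    exact hk ((Nat.dvd_add_right (Dvd.intro _ rfl)).mp h4)

theorem orbitCount_embed_of_even {n k : ℕ} (hn : Odd n) [NeZero n] (hk : Even k) :
    orbitCount (embed n (gA n ^ k * gB n)) = if 4 ∣ k then 2 * n + 2 else 2 * n := by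
  have hsq : embed n (gA n ^ k * gB n) ^ 2 = 1 := by
    obtain ⟨l, rfl⟩ := hk
    have h0 : ((2 * n * (l + l) : ℕ) : ZMod (4 * n)) = 0 := by
      push_cast
      linear_combination (l : ZMod (4 * n)) * four_mul_cast n
    rw [embed_gA_pow_mul_gB_sq, h0, Equiv.addRight_zero]
  have hburnside := sum_card_fixedPoints hsq
  simp only [Finset.sum_range_succ, Finset.sum_range_zero, pow_zero, pow_one, Equiv.Perm.one_apply,
    Finset.filter_true, Finset.card_univ, ZMod.card, card_fixed_embed_gA_pow_mul_gB hn] at hburnside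
  split_ifs at hburnside ⊢ <;> omega

theorem two_mul_natCast_ne_zero (n : ℕ) [NeZero n] : ((2 * n : ℕ) : ZMod (4 * n)) ≠ 0 := by
  rw [Ne, ZMod.natCast_eq_zero_iff]
  have hn := NeZero.pos n
  exact Nat.not_dvd_of_pos_of_lt (by omega) (by omega)

theorem orbitCount_embed_of_odd {n k : ℕ} [NeZero n] (hk : Odd k) :
    orbitCount (embed n (gA n ^ k * gB n)) = n := by
  set σ := embed n (gA n ^ k * gB n) with hσ
  have hsq : σ ^ 2 = Equiv.addRight ((2 * n : ℕ) : ZMod (4 * n)) := by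
    obtain ⟨l, rfl⟩ := hk
    rw [hσ, embed_gA_pow_mul_gB_sq]
    congr 1
    push_cast
    linear_combination (l : ZMod (4 * n)) * four_mul_cast n
  have hpow_four : σ ^ 4 = 1 := by
    have h0 : ((2 * n : ℕ) : ZMod (4 * n)) + (2 * n : ℕ) = 0 := by
      push_cast
      linear_combination four_mul_cast n
    rw [pow_mul σ 2 2, hsq, sq, ← Equiv.addRight_add, h0, Equiv.addRight_zero]
  have hsq_fixed : ∀ t, (σ ^ 2) t ≠ t := by
    intro t
    rw [hsq, Equiv.coe_addRight, Ne, add_eq_left]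
    exact two_mul_natCast_ne_zero n
  have hfixed : ∀ t, σ t ≠ t := fun t ht =>
    hsq_fixed t (Equiv.Perm.pow_apply_eq_self_of_apply_eq_self ht 2)
  have hcube_fixed : ∀ t, (σ ^ 3) t ≠ t := by
    intro t ht
    refine hfixed t ?_
    rw [← ht, ← Equiv.Perm.mul_apply, ← pow_succ', hpow_four, ht, Equiv.Perm.one_apply]
  have hburnside := sum_card_fixedPoints hpow_four
  simp only [Finset.sum_range_succ, Finset.sum_range_zero, pow_zero, pow_one, Equiv.Perm.one_apply,
    hsq_fixed, hfixed, hcube_fixed, Finset.filter_true, Finset.filter_false, Finset.card_univ,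
    Finset.card_empty, ZMod.card] at hburnside
  omega

theorem IsConvIdempotent.dimClass_eq {n : ℕ} [NeZero n] {χ : SD n → ℂ} (hχ : IsConvIdempotent χ)
    (V : Type*) [AddCommGroup V] [Module ℂ V] [FiniteDimensional ℂ V] :
    (dimClass n V χ : ℂ) = χ 1 / (8 * n) *
      (∑ k ∈ Finset.range (4 * n), χ (gA n ^ k) * (Module.finrank ℂ V : ℂ) ^ (4 * n).gcd k +
        ∑ k ∈ Finset.range (4 * n), χ (gA n ^ k * gB n) *
          (Module.finrank ℂ V : ℂ) ^ orbitCount (embed n (gA n ^ k * gB n))) := by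
  rw [dimClass, hχ.finrank_symmetryClass (embed n) V, card_SD, finsum_SD]
  simp only [orbitCount_embed_gA_pow]
  push_cast
  rfl

/-! ### Index sets -/

theorem mem_CdagEven {n k : ℕ} : k ∈ CdagEven n ↔ Even k ∧ 0 < k ∧ k < 2 * n := by
  simp only [CdagEven, C1, Finset.mem_sdiff, Finset.mem_filter, Finset.mem_Icc, Finset.mem_insert,
    Finset.mem_singleton, Nat.even_iff]
  omega

theorem mem_CdagOdd {n k : ℕ} :
    k ∈ CdagOdd n ↔ Odd k ∧ (k < n ∨ 2 * n < k ∧ k < 3 * n) := by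
  simp only [CdagOdd, Finset.mem_filter, Finset.mem_union, Finset.mem_Icc, Nat.odd_iff]
  omega

theorem not_dvd_of_mem_CdagEven {n h : ℕ} (hn : Odd n) (hh : h ∈ CdagEven n) : ¬ n ∣ h := by
  obtain ⟨heven, hpos, hlt⟩ := mem_CdagEven.mp hh
  rintro ⟨c, rfl⟩
  have hc : c < 2 := Nat.lt_of_mul_lt_mul_left (a := n) (by omega)
  interval_cases c
  · exact absurd hpos (lt_irrefl _)
  · exact Nat.not_even_iff_odd.mpr hn (by simpa using heven)

theorem not_dvd_of_mem_Codd23_sdiff {n h : ℕ} (hh : h ∈ Codd23 n \ {n, 3 * n}) : ¬ n ∣ h := by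
  simp only [Codd23, Finset.mem_sdiff, Finset.mem_filter, Finset.mem_union, Finset.mem_Icc,
    Finset.mem_insert, Finset.mem_singleton] at hh
  rintro ⟨c, rfl⟩
  have hc : c < 4 := Nat.lt_of_mul_lt_mul_left (a := n) (by omega)
  interval_cases c <;> omega

theorem bar_CdagEven (n : ℕ) : bar n (CdagEven n) = (CdagEven n).image (4 * n - ·) := by
  refine Finset.image_congr fun s hs => ?_
  obtain ⟨⟨u, rfl⟩, h0, h1⟩ := mem_CdagEven.mp hs
  have hprod : (u + u) * (2 * n - 1) = 4 * n - (u + u) + 4 * n * (u - 1) := by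
    zify [show 1 ≤ 2 * n by omega, show u + u ≤ 4 * n by omega, show 1 ≤ u by omega]
    ring
  change (u + u) * (2 * n - 1) % (4 * n) = 4 * n - (u + u)
  rw [hprod, Nat.add_mul_mod_self_left, Nat.mod_eq_of_lt (by omega)]

theorem bar_CdagOdd (n : ℕ) : bar n (CdagOdd n) =
    (CdagOdd n).image fun s => if s < n then 2 * n - s else 6 * n - s := by
  refine Finset.image_congr fun s hs => ?_
  obtain ⟨⟨u, rfl⟩, h⟩ := mem_CdagOdd.mp hs
  change (2 * u + 1) * (2 * n - 1) % (4 * n) = if _ then _ else _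
  split_ifs with hlt
  · have hprod : (2 * u + 1) * (2 * n - 1) = 2 * n - (2 * u + 1) + 4 * n * u := by
      zify [show 1 ≤ 2 * n by omega, show 2 * u + 1 ≤ 2 * n by omega]
      ring
    rw [hprod, Nat.add_mul_mod_self_left, Nat.mod_eq_of_lt (by omega)]
  · have hprod : (2 * u + 1) * (2 * n - 1) = 6 * n - (2 * u + 1) + 4 * n * (u - 1) := by
      zify [show 1 ≤ 2 * n by omega, show 2 * u + 1 ≤ 6 * n by omega, show 1 ≤ u by omega]
      ring
    rw [hprod, Nat.add_mul_mod_self_left, Nat.mod_eq_of_lt (by omega)]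

theorem CdagEven_union_bar (n : ℕ) : CdagEven n ∪ bar n (CdagEven n) =
    {k ∈ Finset.range (4 * n) | Even k ∧ k ≠ 0 ∧ k ≠ 2 * n} := by
  ext k
  simp only [bar_CdagEven, Finset.mem_union, Finset.mem_image, mem_CdagEven, Finset.mem_filter,
    Finset.mem_range, Nat.even_iff]
  constructor
  · rintro (h | ⟨s, h, rfl⟩) <;> omega
  · intro h
    rcases lt_or_ge k (2 * n) with hk | hk
    · left
      omega
    · right
      exact ⟨4 * n - k, by omega, by omega⟩

theorem CdagOdd_union_bar {n : ℕ} (hn : Odd n) : CdagOdd n ∪ bar n (CdagOdd n) =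
    {k ∈ Finset.range (4 * n) | Odd k ∧ k ≠ n ∧ k ≠ 3 * n} := by
  ext k
  simp only [bar_CdagOdd, Finset.mem_union, Finset.mem_image, mem_CdagOdd, Finset.mem_filter,
    Finset.mem_range, Nat.odd_iff] at hn ⊢
  constructor
  · rintro (h | ⟨s, h, rfl⟩)
    · omega
    · split_ifs <;> omega
  · intro h
    by_cases hk : k < n ∨ 2 * n < k ∧ k < 3 * n
    · left
      omega
    · right
      rcases lt_or_ge k (2 * n) with hlt | hge
      · exact ⟨2 * n - k, by omega, by rw [if_pos (by omega)]; omega⟩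
      · exact ⟨6 * n - k, by omega, by rw [if_neg (by omega)]; omega⟩

theorem sum_filter_even {M : Type*} [AddCommMonoid M] (n : ℕ) [NeZero n] (f : ℕ → M) :
    ∑ k ∈ Finset.range (4 * n) with Even k, f k =
      f 0 + (f (2 * n) + ∑ k ∈ CdagEven n ∪ bar n (CdagEven n), f k) := by
  have hn := NeZero.pos n
  rw [CdagEven_union_bar, ← Finset.sum_insert (by simp),
    ← Finset.sum_insert (by simp [NeZero.ne n])]
  congr 1
  ext k
  simp only [Finset.mem_filter, Finset.mem_range, Finset.mem_insert, Nat.even_iff]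
  omega

theorem sum_filter_not_even {M : Type*} [AddCommMonoid M] {n : ℕ} (hn : Odd n) (f : ℕ → M) :
    ∑ k ∈ Finset.range (4 * n) with ¬ Even k, f k =
      f n + (f (3 * n) + ∑ k ∈ CdagOdd n ∪ bar n (CdagOdd n), f k) := by
  have hpos := hn.pos
  rw [CdagOdd_union_bar hn, ← Finset.sum_insert (by simp),
    ← Finset.sum_insert (by simp [hpos.ne'])]
  congr 1
  ext k
  simp only [Finset.mem_filter, Finset.mem_range, Finset.mem_insert, Nat.even_iff,
    Nat.odd_iff] at hn ⊢
  omega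

theorem sum_CdagEven_union_bar {R : Type*} [NonAssocSemiring R] {n : ℕ} {f : ℕ → R}
    (hf : ∀ k ∈ CdagEven n, f (4 * n - k) = f k) :
    ∑ k ∈ CdagEven n ∪ bar n (CdagEven n), f k = 2 * ∑ k ∈ CdagEven n, f k := by
  have hdisj : Disjoint (CdagEven n) (bar n (CdagEven n)) := by
    rw [bar_CdagEven, Finset.disjoint_right]
    intro k hk
    obtain ⟨s, hs, rfl⟩ := Finset.mem_image.mp hk
    rw [mem_CdagEven] at hs ⊢
    omega
  have hinj : Set.InjOn (4 * n - ·) (CdagEven n : Set ℕ) := by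
    intro x hx y hy hxy
    have := mem_CdagEven.mp hx
    have := mem_CdagEven.mp hy
    simp only at hxy
    omega
  rw [Finset.sum_union hdisj, bar_CdagEven, Finset.sum_image hinj, Finset.sum_congr rfl hf, two_mul]

theorem sum_range_of_odd_antisymm {M : Type*} [AddCommGroup M] {n : ℕ} [NeZero n] {f : ℕ → M}
    (hf : ∀ k, Odd k → k < 4 * n → f (4 * n - k) = -f k) :
    ∑ k ∈ Finset.range (4 * n), f k =
      f 0 + (f (2 * n) + ∑ k ∈ CdagEven n ∪ bar n (CdagEven n), f k) := by
  have hodd : ∑ k ∈ Finset.range (4 * n) with ¬ Even k, f k = 0 := by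
    refine Finset.sum_involution (fun k _ => 4 * n - k) ?_ ?_ ?_ ?_ <;>
      simp only [Finset.mem_filter, Finset.mem_range, Nat.not_even_iff_odd]
    · rintro k ⟨hlt, hk⟩
      rw [hf k hk hlt, add_neg_cancel]
    · rintro k ⟨-, hk⟩ -
      rw [Nat.odd_iff] at hk
      omega
    · rintro k ⟨hlt, hk⟩
      rw [Nat.odd_iff] at hk ⊢
      omega
    · rintro k ⟨hlt, -⟩
      omega
  rw [← Finset.sum_filter_add_sum_filter_not _ (Even ·), hodd, add_zero, sum_filter_even]

theorem gcd_four_mul_two_mul (n : ℕ) : (4 * n).gcd (2 * n) = 2 * n := by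
  rw [Nat.gcd_mul_right]
  rfl

theorem gcd_four_mul_three_mul (n : ℕ) : (4 * n).gcd (3 * n) = n := by
  rw [Nat.gcd_mul_right, show Nat.gcd 4 3 = 1 from rfl, one_mul]

/-! ### Linear characters -/

theorem sum_neg_one_pow_mul {R : Type*} [Ring R] (s : Finset ℕ) (f : ℕ → R) :
    ∑ k ∈ s, (-1) ^ k * f k = ∑ k ∈ s with Even k, f k - ∑ k ∈ s with ¬ Even k, f k := by
  rw [← Finset.sum_filter_add_sum_filter_not s (Even ·), sub_eq_add_neg, ← Finset.sum_neg_distrib]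
  congr 1 <;> refine Finset.sum_congr rfl fun k hk => ?_
  · rw [(Finset.mem_filter.mp hk).2.neg_one_pow, one_mul]
  · rw [(Nat.not_even_iff_odd.mp (Finset.mem_filter.mp hk).2).neg_one_pow, neg_one_mul]

theorem pow_of_sq_eq_neg_one_of_even {R : Type*} [Ring R] {x : R} (hx : x ^ 2 = -1) {k : ℕ}
    (hk : Even k) : x ^ k = (-1) ^ (k / 2) := by
  rw [← hx, ← pow_mul, Nat.two_mul_div_two_of_even hk]

theorem pow_four_mul_sub_of_sq_eq_neg_one {R : Type*} [Ring R] {x : R} (hx : x ^ 2 = -1) {n k : ℕ}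
    (hk : Odd k) (hlt : k < 4 * n) : x ^ (4 * n - k) = -x ^ k := by
  obtain ⟨l, rfl⟩ := hk
  obtain ⟨p, hp⟩ : ∃ p, 2 * n = l + p + 1 := ⟨2 * n - (l + 1), by omega⟩
  have hsign : (-1 : R) ^ p = -(-1) ^ l := by
    rw [← neg_one_mul (_ ^ l), ← pow_succ']
    exact neg_one_pow_congr (by simp only [Nat.even_iff]; omega)
  rw [show 4 * n - (2 * l + 1) = 2 * p + 1 by omega, pow_succ, pow_succ, pow_mul, pow_mul, hx,
    hsign, neg_mul]

theorem orbitCount_embed_add_four {n : ℕ} (hn : Odd n) [NeZero n] (k : ℕ) :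
    orbitCount (embed n (gA n ^ (k + 4) * gB n)) = orbitCount (embed n (gA n ^ k * gB n)) := by
  rcases Nat.even_or_odd k with hk | hk
  · have hk' : Even (k + 4) := hk.add (by decide)
    simp only [orbitCount_embed_of_even hn hk, orbitCount_embed_of_even hn hk',
      Nat.dvd_add_self_right]
  · have hk' : Odd (k + 4) := hk.add_even (by decide)
    rw [orbitCount_embed_of_odd hk, orbitCount_embed_of_odd hk']

section LinearCharacter

variable {n : ℕ} (hn : Odd n) {α β : ℂˣ} (hα : α ^ 4 = 1) (hβ : β ^ 2 = 1)

theorem linChar_mul (g g' : SD n) :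
    linChar n hn α β hα hβ (g * g') = linChar n hn α β hα hβ g * linChar n hn α β hα hβ g' := by
  simp only [linChar, map_mul, Units.val_mul]

theorem linChar_one : linChar n hn α β hα hβ 1 = 1 := by
  rw [linChar, map_one, Units.val_one]

theorem linChar_gA_pow (k : ℕ) : linChar n hn α β hα hβ (gA n ^ k) = (α : ℂ) ^ k := by
  rw [linChar, map_pow, lift_a, Units.val_pow_eq_pow_val]

theorem linChar_gA_pow_mul_gB (k : ℕ) :
    linChar n hn α β hα hβ (gA n ^ k * gB n) = (α : ℂ) ^ k * β := by
  rw [linChar, map_mul, map_pow, lift_a, lift_b, Units.val_mul, Units.val_pow_eq_pow_val]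

theorem isConvIdempotent_linChar : IsConvIdempotent (linChar n hn α β hα hβ) := by
  intro g
  have := NeZero.of_pos hn.pos
  have := Fintype.ofFinite (SD n)
  simp only [← linChar_mul, mul_inv_cancel_left, linChar_one, one_mul, finsum_eq_sum_of_fintype,
    Finset.sum_const, Finset.card_univ, nsmul_eq_mul, Nat.card_eq_fintype_card]

variable {V : Type*} [AddCommGroup V] [Module ℂ V] [FiniteDimensional ℂ V] {m : ℕ} {ε : ℝ}

theorem dimClass_linChar (hm : Module.finrank ℂ V = m) :
    (dimClass n V (linChar n hn α β hα hβ) : ℂ) = 1 / (8 * n) *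
      (∑ k ∈ Finset.range (4 * n), (α : ℂ) ^ k * (m : ℂ) ^ (4 * n).gcd k +
        n * β * (m ^ (2 * n + 2) + (α : ℂ) ^ 2 * m ^ (2 * n) + (α + (α : ℂ) ^ 3) * m ^ n)) := by
  have := NeZero.of_pos hn.pos
  have hα' : (α : ℂ) ^ 4 = 1 := by rw [← Units.val_pow_eq_pow_val, hα, Units.val_one]
  have hper : Function.Periodic
      (fun k => (α : ℂ) ^ k * β * (m : ℂ) ^ orbitCount (embed n (gA n ^ k * gB n))) 4 := by
    intro k
    simp only [pow_add (α : ℂ), hα', mul_one, orbitCount_embed_add_four hn]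
  rw [(isConvIdempotent_linChar hn hα hβ).dimClass_eq V, linChar_one, hm]
  simp only [linChar_gA_pow, linChar_gA_pow_mul_gB]
  rw [sum_range_mul_of_periodic hper]
  simp only [Finset.sum_range_succ, Finset.sum_range_zero]
  rw [orbitCount_embed_of_even hn (k := 0) (by decide),
    orbitCount_embed_of_odd (k := 1) (by decide),
    orbitCount_embed_of_even hn (k := 2) (by decide),
    orbitCount_embed_of_odd (k := 3) (by decide),
    if_pos (by decide), if_neg (by decide), nsmul_eq_mul]
  ring

theorem dimClass_linChar_one (hm : Module.finrank ℂ V = m) (hε : (β : ℂ) = ε) :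
    (dimClass n V (linChar n hn 1 β (one_pow 4) hβ) : ℝ) = 1 / (8 * n) *
      (ε * (2 * n * m ^ n + n * m ^ (2 * n) + n * m ^ (2 * n + 2)) +
        ∑ k ∈ Finset.range (4 * n), (m : ℝ) ^ (4 * n).gcd k) := by
  apply Complex.ofReal_injective
  rw [Complex.ofReal_natCast, dimClass_linChar hn _ hβ hm, hε]
  simp only [Units.val_one, one_pow, one_mul]
  push_cast
  ring

theorem dimClass_linChar_neg_one (hm : Module.finrank ℂ V = m) (hε : (β : ℂ) = ε) :
    (dimClass n V (linChar n hn (-1) β neg_one_pow_four hβ) : ℝ) = 1 / (8 * n) *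
      (m ^ (4 * n) + m ^ (2 * n) - 2 * m ^ n
        + 2 * ∑ k ∈ CdagEven n, (m : ℝ) ^ (4 * n).gcd k
        - ∑ k ∈ CdagOdd n ∪ bar n (CdagOdd n), (m : ℝ) ^ (4 * n).gcd k
        + ε * (-(2 * n * m ^ n) + n * m ^ (2 * n) + n * m ^ (2 * n + 2))) := by
  have := NeZero.of_pos hn.pos
  have hsymm : ∀ k ∈ CdagEven n, (m : ℂ) ^ (4 * n).gcd (4 * n - k) = (m : ℂ) ^ (4 * n).gcd k :=
    fun k hk => by rw [Nat.gcd_self_sub_right (by have := mem_CdagEven.mp hk; omega)]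
  apply Complex.ofReal_injective
  rw [Complex.ofReal_natCast, dimClass_linChar hn _ hβ hm, hε]
  simp only [Units.val_neg, Units.val_one]
  rw [sum_neg_one_pow_mul, sum_filter_even, sum_filter_not_even hn, sum_CdagEven_union_bar hsymm,
    gcd_four_mul_two_mul, gcd_four_mul_three_mul, Nat.gcd_mul_left_left, Nat.gcd_zero_right]
  push_cast
  ring

theorem dimClass_linChar_of_sq_eq_neg_one (hm : Module.finrank ℂ V = m) (hε : (β : ℂ) = ε)
    (hα2 : (α : ℂ) ^ 2 = -1) :
    (dimClass n V (linChar n hn α β hα hβ) : ℝ) = 1 / (8 * n) *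
      (m ^ (4 * n) - m ^ (2 * n)
        + ∑ k ∈ CdagEven n ∪ bar n (CdagEven n), (-1 : ℝ) ^ (k / 2) * (m : ℝ) ^ (4 * n).gcd k
        + ε * (n * m ^ (2 * n + 2) - n * m ^ (2 * n))) := by
  have := NeZero.of_pos hn.pos
  have hantisymm : ∀ k, Odd k → k < 4 * n →
      (α : ℂ) ^ (4 * n - k) * (m : ℂ) ^ (4 * n).gcd (4 * n - k) =
        -((α : ℂ) ^ k * (m : ℂ) ^ (4 * n).gcd k) := fun k hk hlt => by
    rw [pow_four_mul_sub_of_sq_eq_neg_one hα2 hk hlt, Nat.gcd_self_sub_right hlt.le, neg_mul]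
  have heven : ∑ k ∈ CdagEven n ∪ bar n (CdagEven n), (α : ℂ) ^ k * (m : ℂ) ^ (4 * n).gcd k =
      ∑ k ∈ CdagEven n ∪ bar n (CdagEven n), (-1 : ℂ) ^ (k / 2) * (m : ℂ) ^ (4 * n).gcd k := by
    refine Finset.sum_congr rfl fun k hk => ?_
    rw [CdagEven_union_bar, Finset.mem_filter] at hk
    rw [pow_of_sq_eq_neg_one_of_even hα2 hk.2.1]
  apply Complex.ofReal_injective
  rw [Complex.ofReal_natCast, dimClass_linChar hn hα hβ hm, hε, sum_range_of_odd_antisymm hantisymm,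
    heven, gcd_four_mul_two_mul, Nat.gcd_zero_right, pow_mul _ 2 n, hα2, hn.neg_one_pow,
    pow_succ (α : ℂ) 2, hα2]
  push_cast
  ring

end LinearCharacter

/-! ### Characters of degree two -/

theorem sum_zpow_add_zpow_conv {K : Type*} [Field K] {α β : K} {N : ℕ} (hα : α ^ N = 1)
    (hβ : β ^ N = 1) (hne : α ≠ β) (k : ℤ) :
    ∑ r ∈ Finset.range N, (α ^ (r : ℤ) + β ^ (r : ℤ)) * (α ^ (k - r) + β ^ (k - r)) =
      N * (α ^ k + β ^ k) := by
  rcases eq_or_ne N 0 with rfl | hN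
  · rw [Finset.range_zero, Finset.sum_empty, Nat.cast_zero, zero_mul]
  have hα0 : α ≠ 0 := (IsUnit.of_pow_eq_one hα hN).ne_zero
  have hβ0 : β ≠ 0 := (IsUnit.of_pow_eq_one hβ hN).ne_zero
  have hαβ : ∑ r ∈ Finset.range N, (α / β) ^ r = 0 := by
    rw [geom_sum_eq (by rwa [Ne, div_eq_one_iff_eq hβ0]), div_pow, hα, hβ, div_one, sub_self,
      zero_div]
  have hβα : ∑ r ∈ Finset.range N, (β / α) ^ r = 0 := by
    rw [geom_sum_eq (by rwa [Ne, div_eq_one_iff_eq hα0, eq_comm]), div_pow, hα, hβ, div_one,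
      sub_self, zero_div]
  calc ∑ r ∈ Finset.range N, (α ^ (r : ℤ) + β ^ (r : ℤ)) * (α ^ (k - r) + β ^ (k - r))
      = ∑ r ∈ Finset.range N, ((α ^ k + β ^ k) + β ^ k * (α / β) ^ r + α ^ k * (β / α) ^ r) := by
        refine Finset.sum_congr rfl fun r _ => ?_
        rw [zpow_sub₀ hα0, zpow_sub₀ hβ0, zpow_natCast, zpow_natCast, div_pow, div_pow]
        field_simp
        ring
    _ = N * (α ^ k + β ^ k) := by
        rw [Finset.sum_add_distrib, Finset.sum_add_distrib, ← Finset.mul_sum, ← Finset.mul_sum,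
          hαβ, hβα, Finset.sum_const, Finset.card_range, nsmul_eq_mul]
        ring

section DegreeTwo

variable (n h : ℕ)

theorem rhoChar_one : rhoChar n h 1 = 2 := by
  rw [rhoChar, map_one, Units.val_one, Matrix.trace_one, Fintype.card_fin, Nat.cast_ofNat]

theorem rhoChar_gA_pow_mul_gB (k : ℕ) : rhoChar n h (gA n ^ k * gB n) = 0 := by
  rw [← zpow_natCast, rhoChar_a_zpow_b]

theorem omega_pow_add_inv (j : ℕ) :
    omega n ^ j + (omega n ^ j)⁻¹ = ((2 * Real.cos (j * Real.pi / (2 * n)) : ℝ) : ℂ) := by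
  rw [omega, ← Complex.exp_nat_mul, ← Complex.exp_neg, Complex.ofReal_mul, Complex.ofReal_ofNat,
    Complex.ofReal_cos, Complex.two_cos]
  push_cast
  congr 2 <;> ring

variable [NeZero n]

theorem isPrimitiveRoot_omega : IsPrimitiveRoot (omega n) (4 * n) := by
  have hn : (n : ℂ) ≠ 0 := NeZero.ne _
  convert Complex.isPrimitiveRoot_exp (4 * n) (NeZero.ne _) using 1
  rw [omega]
  congr 1
  push_cast
  field_simp
  ring

theorem omega_pow_two_mul : omega n ^ (2 * n) = -1 := by
  have hn : (n : ℂ) ≠ 0 := NeZero.ne _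
  rw [omega, ← Complex.exp_nat_mul, ← Complex.exp_pi_mul_I]
  congr 1
  push_cast
  field_simp

variable {n h} in
/-- The two eigenvalues of `ρ^h(a)` differ, which is what makes `ρ^h` irreducible. -/
theorem omega_zpow_ne_omega_zpow (hh : ¬ n ∣ h) :
    omega n ^ (h : ℤ) ≠ omega n ^ ((2 * (n : ℤ) - 1) * h) := by
  intro heq
  have hone : omega n ^ ((2 * (n : ℤ) - 1) * h - h) = 1 := by
    rw [zpow_sub₀ (omega_ne_zero n), ← heq, div_self (zpow_ne_zero _ (omega_ne_zero n))]
  obtain ⟨c, hc⟩ := ((isPrimitiveRoot_omega n).zpow_eq_one_iff_dvd _).mp hone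
  push_cast at hc
  exact hh (Int.natCast_dvd_natCast.mp ⟨h - 2 * c, by linarith⟩)

theorem rhoChar_gA_pow (k : ℕ) : rhoChar n h (gA n ^ k) =
    omega n ^ (h * k) + (-1) ^ (h * k) * (omega n ^ (h * k))⁻¹ := by
  rw [← zpow_natCast, rhoChar_a_zpow, ← omega_pow_two_mul n, ← pow_mul, ← zpow_natCast,
    ← zpow_natCast, ← zpow_neg, ← zpow_add₀ (omega_ne_zero n)]
  push_cast
  congr 2
  ring

variable {n h} in
theorem rhoChar_gA_pow_of_even {k : ℕ} (hk : Even (h * k)) :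
    rhoChar n h (gA n ^ k) = ((2 * Real.cos (h * k * Real.pi / (2 * n)) : ℝ) : ℂ) := by
  rw [rhoChar_gA_pow, hk.neg_one_pow, one_mul, omega_pow_add_inv, Nat.cast_mul]

variable {n} in
theorem rhoChar_gA_pow_four_mul_sub {k : ℕ} (hk : k ≤ 4 * n) :
    rhoChar n h (gA n ^ (4 * n - k)) = (-1) ^ (h * k) * rhoChar n h (gA n ^ k) := by
  have hinv : omega n ^ (h * (4 * n - k)) = (omega n ^ (h * k))⁻¹ := by
    refine eq_inv_of_mul_eq_one_left ?_
    rw [← pow_add, ← mul_add, Nat.sub_add_cancel hk, mul_comm, pow_mul, omega_pow, one_pow]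
  have hsign : (-1 : ℂ) ^ (h * (4 * n - k)) = (-1) ^ (h * k) := by
    refine neg_one_pow_congr ?_
    have hfour : Even (4 * n) := (by decide : Even 4).mul_right n
    rw [Nat.even_mul, Nat.even_mul, Nat.even_sub hk, iff_true_left hfour]
  have hsq : (-1 : ℂ) ^ (h * k) * (-1) ^ (h * k) = 1 := by
    rw [← mul_pow, neg_one_mul, neg_neg, one_pow]
  rw [rhoChar_gA_pow, rhoChar_gA_pow, hinv, hsign, inv_inv]
  linear_combination (-(omega n ^ (h * k))⁻¹) * hsq

variable {n h} in
theorem isConvIdempotent_rhoChar (hh : ¬ n ∣ h) : IsConvIdempotent (rhoChar n h) := by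
  have hpow : ∀ j : ℤ, (omega n ^ j) ^ (4 * n) = 1 := by
    intro j
    rw [← zpow_natCast, ← zpow_mul, mul_comm]
    exact_mod_cast omega_zpow n j
  intro g
  rw [finsum_SD, rhoChar_one, card_SD]
  simp only [← zpow_natCast, rhoChar_a_zpow_b, zero_mul, Finset.sum_const_zero, add_zero]
  obtain ⟨i, rfl | rfl⟩ := exists_normal_form n g
  · have hconv := sum_zpow_add_zpow_conv (hpow h) (hpow _) (omega_zpow_ne_omega_zpow hh) i
    simp only [← zpow_mul] at hconv
    simp only [← zpow_neg, ← zpow_add, rhoChar_a_zpow, neg_add_eq_sub, hconv]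
    push_cast
    ring
  · simp only [← mul_assoc, ← zpow_neg, ← zpow_add, rhoChar_a_zpow_b, mul_zero,
      Finset.sum_const_zero]

variable {n h} {V : Type*} [AddCommGroup V] [Module ℂ V] [FiniteDimensional ℂ V] {m : ℕ}

theorem dimClass_rhoChar (hh : ¬ n ∣ h) (hm : Module.finrank ℂ V = m) :
    (dimClass n V (rhoChar n h) : ℂ) = 1 / (4 * n) *
      ∑ k ∈ Finset.range (4 * n), rhoChar n h (gA n ^ k) * (m : ℂ) ^ (4 * n).gcd k := by
  rw [(isConvIdempotent_rhoChar hh).dimClass_eq V, rhoChar_one, hm]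
  simp only [rhoChar_gA_pow_mul_gB, zero_mul, Finset.sum_const_zero, add_zero]
  ring

theorem dimClass_rhoChar_even (hh : ¬ n ∣ h) (hm : Module.finrank ℂ V = m) (heven : Even h) :
    (dimClass n V (rhoChar n h) : ℝ) = 1 / (2 * n) *
      ∑ k ∈ Finset.range (4 * n),
        (m : ℝ) ^ (4 * n).gcd k * Real.cos (h * k * Real.pi / (2 * n)) := by
  apply Complex.ofReal_injective
  rw [Complex.ofReal_natCast, dimClass_rhoChar hh hm]
  simp only [rhoChar_gA_pow_of_even (heven.mul_right _)]
  push_cast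
  simp only [Finset.mul_sum]
  exact Finset.sum_congr rfl fun k _ => by ring

theorem dimClass_rhoChar_odd (hh : ¬ n ∣ h) (hm : Module.finrank ℂ V = m) (hodd : Odd h) :
    (dimClass n V (rhoChar n h) : ℝ) = 1 / (4 * n) *
      (2 * m ^ (4 * n) - 2 * m ^ (2 * n) + 4 * ∑ k ∈ CdagEven n,
        (m : ℝ) ^ (4 * n).gcd k * Real.cos (h * k * Real.pi / (2 * n))) := by
  set f : ℕ → ℂ := fun k => rhoChar n h (gA n ^ k) * (m : ℂ) ^ (4 * n).gcd k with hf
  have hreflect : ∀ k ≤ 4 * n, f (4 * n - k) = (-1) ^ (h * k) * f k := fun k hk => by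
    simp only [hf, rhoChar_gA_pow_four_mul_sub h hk, Nat.gcd_self_sub_right hk, mul_assoc]
  have hantisymm : ∀ k, Odd k → k < 4 * n → f (4 * n - k) = -f k := fun k hk hlt => by
    rw [hreflect k hlt.le, (hodd.mul hk).neg_one_pow, neg_one_mul]
  have hsymm : ∀ k ∈ CdagEven n, f (4 * n - k) = f k := fun k hk => by
    obtain ⟨heven, -, hlt⟩ := mem_CdagEven.mp hk
    rw [hreflect k (by omega), (heven.mul_left h).neg_one_pow, one_mul]
  have hzero : f 0 = 2 * (m : ℂ) ^ (4 * n) := by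
    simp only [hf, pow_zero, rhoChar_one, Nat.gcd_zero_right]
  have htwo : f (2 * n) = -2 * (m : ℂ) ^ (2 * n) := by
    have hw : omega n ^ (h * (2 * n)) = -1 := by
      rw [mul_comm, pow_mul, omega_pow_two_mul, hodd.neg_one_pow]
    simp only [hf, gcd_four_mul_two_mul, rhoChar_gA_pow, hw,
      ((even_two_mul n).mul_left h).neg_one_pow]
    norm_num
  have hsum : ∑ k ∈ CdagEven n, f k = ((2 * ∑ k ∈ CdagEven n,
      (m : ℝ) ^ (4 * n).gcd k * Real.cos (h * k * Real.pi / (2 * n)) : ℝ) : ℂ) := by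
    rw [Finset.mul_sum, Complex.ofReal_sum]
    refine Finset.sum_congr rfl fun k hk => ?_
    simp only [hf, rhoChar_gA_pow_of_even ((mem_CdagEven.mp hk).1.mul_left h)]
    push_cast
    ring
  apply Complex.ofReal_injective
  rw [Complex.ofReal_natCast, dimClass_rhoChar hh hm, sum_range_of_odd_antisymm hantisymm,
    sum_CdagEven_union_bar hsymm, hzero, htwo, hsum]
  push_cast
  ring

end DegreeTwo

end SemiDihedral

open SemiDihedral in
theorem theorem2p10_general (n : ℕ) (hn : Odd n)
    (V : Type*) [AddCommGroup V] [Module ℂ V] [FiniteDimensional ℂ V]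
    (m : ℕ) (hm : Module.finrank ℂ V = m) :
    (dimClass n V (chi0 n hn) : ℝ) = 1 / (8 * n) *
      (2 * n * m ^ n + n * m ^ (2 * n) + n * m ^ (2 * n + 2)
        + ∑ k ∈ Finset.range (4 * n), (m : ℝ) ^ Nat.gcd (4 * n) k) ∧
    (dimClass n V (chi1 n hn) : ℝ) = 1 / (8 * n) *
      (-(2 * n * m ^ n) - n * m ^ (2 * n) - n * m ^ (2 * n + 2)
        + ∑ k ∈ Finset.range (4 * n), (m : ℝ) ^ Nat.gcd (4 * n) k) ∧
    (dimClass n V (chi2 n hn) : ℝ) = 1 / (8 * n) *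
      (m ^ (4 * n) + m ^ (2 * n) - 2 * m ^ n
        + 2 * ∑ k ∈ CdagEven n, (m : ℝ) ^ Nat.gcd (4 * n) k
        - ∑ k ∈ CdagOdd n ∪ bar n (CdagOdd n), (m : ℝ) ^ Nat.gcd (4 * n) k
        - 2 * n * m ^ n + n * m ^ (2 * n) + n * m ^ (2 * n + 2)) ∧
    (dimClass n V (chi3 n hn) : ℝ) = 1 / (8 * n) *
      (m ^ (4 * n) + m ^ (2 * n) - 2 * m ^ n
        + 2 * ∑ k ∈ CdagEven n, (m : ℝ) ^ Nat.gcd (4 * n) k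
        - ∑ k ∈ CdagOdd n ∪ bar n (CdagOdd n), (m : ℝ) ^ Nat.gcd (4 * n) k
        + 2 * n * m ^ n - n * m ^ (2 * n) - n * m ^ (2 * n + 2)) ∧
    (dimClass n V (chi4 n hn) : ℝ) = 1 / (8 * n) *
      (m ^ (4 * n) - m ^ (2 * n)
        + ∑ k ∈ CdagEven n ∪ bar n (CdagEven n), (-1 : ℝ) ^ (k / 2) * (m : ℝ) ^ Nat.gcd (4 * n) k
        + n * m ^ (2 * n + 2) - n * m ^ (2 * n)) ∧
    (dimClass n V (chi5 n hn) : ℝ) = 1 / (8 * n) *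
      (m ^ (4 * n) - m ^ (2 * n)
        + ∑ k ∈ CdagEven n ∪ bar n (CdagEven n), (-1 : ℝ) ^ (k / 2) * (m : ℝ) ^ Nat.gcd (4 * n) k
        - n * m ^ (2 * n + 2) + n * m ^ (2 * n)) ∧
    (dimClass n V (chi6 n hn) : ℝ) = 1 / (8 * n) *
      (m ^ (4 * n) - m ^ (2 * n)
        + ∑ k ∈ CdagEven n ∪ bar n (CdagEven n), (-1 : ℝ) ^ (k / 2) * (m : ℝ) ^ Nat.gcd (4 * n) k
        + n * m ^ (2 * n + 2) - n * m ^ (2 * n)) ∧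
    (dimClass n V (chi7 n hn) : ℝ) = 1 / (8 * n) *
      (m ^ (4 * n) - m ^ (2 * n)
        + ∑ k ∈ CdagEven n ∪ bar n (CdagEven n), (-1 : ℝ) ^ (k / 2) * (m : ℝ) ^ Nat.gcd (4 * n) k
        - n * m ^ (2 * n + 2) + n * m ^ (2 * n)) ∧
    (∀ h ∈ CdagEven n,
      (dimClass n V (rhoChar n h) : ℝ) = 1 / (2 * n) *
        ∑ k ∈ Finset.range (4 * n),
          (m : ℝ) ^ Nat.gcd (4 * n) k * Real.cos (h * k * Real.pi / (2 * n))) ∧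
    (∀ h ∈ Codd23 n \ {n, 3 * n},
      (dimClass n V (rhoChar n h) : ℝ) = 1 / (4 * n) *
        (2 * m ^ (4 * n) - 2 * m ^ (2 * n)
          + 4 * ∑ k ∈ CdagEven n,
            (m : ℝ) ^ Nat.gcd (4 * n) k * Real.cos (h * k * Real.pi / (2 * n)))) := by
  have := NeZero.of_pos hn.pos
  have hI : (unitI : ℂ) ^ 2 = -1 := by simp [unitI]
  have hI' : ((-unitI : ℂˣ) : ℂ) ^ 2 = -1 := by simp [unitI]
  have hone : ((1 : ℂˣ) : ℂ) = (1 : ℝ) := by simp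
  have hneg : ((-1 : ℂˣ) : ℂ) = (-1 : ℝ) := by simp
  simp only [chi0, chi1, chi2, chi3, chi4, chi5, chi6, chi7]
  refine ⟨?_, ?_, ?_, ?_, ?_, ?_, ?_, ?_, fun h hh => ?_, fun h hh => ?_⟩
  · linear_combination dimClass_linChar_one (V := V) hn (one_pow 2) hm hone
  · linear_combination dimClass_linChar_one (V := V) hn neg_one_sq hm hneg
  · linear_combination dimClass_linChar_neg_one (V := V) hn (one_pow 2) hm hone
  · linear_combination dimClass_linChar_neg_one (V := V) hn neg_one_sq hm hneg
  · linear_combination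
      dimClass_linChar_of_sq_eq_neg_one (V := V) hn unitI_pow (one_pow 2) hm hone hI
  · linear_combination
      dimClass_linChar_of_sq_eq_neg_one (V := V) hn unitI_pow neg_one_sq hm hneg hI
  · linear_combination
      dimClass_linChar_of_sq_eq_neg_one (V := V) hn neg_unitI_pow (one_pow 2) hm hone hI'
  · linear_combination
      dimClass_linChar_of_sq_eq_neg_one (V := V) hn neg_unitI_pow neg_one_sq hm hneg hI'
  · exact dimClass_rhoChar_even (not_dvd_of_mem_CdagEven hn hh) hm (mem_CdagEven.mp hh).1
  · exact dimClass_rhoChar_odd (not_dvd_of_mem_Codd23_sdiff hh) hm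
      (Finset.mem_filter.mp (Finset.mem_sdiff.mp hh).1).2

open SemiDihedral in
theorem theorem2p10 (n : ℕ) (hn2 : 2 ≤ n) (hn : Odd n)
    (V : Type*) [NormedAddCommGroup V] [InnerProductSpace ℂ V] [FiniteDimensional ℂ V]
    (m : ℕ) (hm : Module.finrank ℂ V = m) :
    (dimClass n V (chi0 n hn) : ℝ) = 1 / (8 * n) *
      (2 * n * m ^ n + n * m ^ (2 * n) + n * m ^ (2 * n + 2)
        + ∑ k ∈ Finset.range (4 * n), (m : ℝ) ^ Nat.gcd (4 * n) k) ∧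
    (dimClass n V (chi1 n hn) : ℝ) = 1 / (8 * n) *
      (-(2 * n * m ^ n) - n * m ^ (2 * n) - n * m ^ (2 * n + 2)
        + ∑ k ∈ Finset.range (4 * n), (m : ℝ) ^ Nat.gcd (4 * n) k) ∧
    (dimClass n V (chi2 n hn) : ℝ) = 1 / (8 * n) *
      (m ^ (4 * n) + m ^ (2 * n) - 2 * m ^ n
        + 2 * ∑ k ∈ CdagEven n, (m : ℝ) ^ Nat.gcd (4 * n) k
        - ∑ k ∈ CdagOdd n ∪ bar n (CdagOdd n), (m : ℝ) ^ Nat.gcd (4 * n) k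
        - 2 * n * m ^ n + n * m ^ (2 * n) + n * m ^ (2 * n + 2)) ∧
    (dimClass n V (chi3 n hn) : ℝ) = 1 / (8 * n) *
      (m ^ (4 * n) + m ^ (2 * n) - 2 * m ^ n
        + 2 * ∑ k ∈ CdagEven n, (m : ℝ) ^ Nat.gcd (4 * n) k
        - ∑ k ∈ CdagOdd n ∪ bar n (CdagOdd n), (m : ℝ) ^ Nat.gcd (4 * n) k
        + 2 * n * m ^ n - n * m ^ (2 * n) - n * m ^ (2 * n + 2)) ∧
    (dimClass n V (chi4 n hn) : ℝ) = 1 / (8 * n) *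
      (m ^ (4 * n) - m ^ (2 * n)
        + ∑ k ∈ CdagEven n ∪ bar n (CdagEven n), (-1 : ℝ) ^ (k / 2) * (m : ℝ) ^ Nat.gcd (4 * n) k
        + n * m ^ (2 * n + 2) - n * m ^ (2 * n)) ∧
    (dimClass n V (chi5 n hn) : ℝ) = 1 / (8 * n) *
      (m ^ (4 * n) - m ^ (2 * n)
        + ∑ k ∈ CdagEven n ∪ bar n (CdagEven n), (-1 : ℝ) ^ (k / 2) * (m : ℝ) ^ Nat.gcd (4 * n) k
        - n * m ^ (2 * n + 2) + n * m ^ (2 * n)) ∧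
    (dimClass n V (chi6 n hn) : ℝ) = 1 / (8 * n) *
      (m ^ (4 * n) - m ^ (2 * n)
        + ∑ k ∈ CdagEven n ∪ bar n (CdagEven n), (-1 : ℝ) ^ (k / 2) * (m : ℝ) ^ Nat.gcd (4 * n) k
        + n * m ^ (2 * n + 2) - n * m ^ (2 * n)) ∧
    (dimClass n V (chi7 n hn) : ℝ) = 1 / (8 * n) *
      (m ^ (4 * n) - m ^ (2 * n)
        + ∑ k ∈ CdagEven n ∪ bar n (CdagEven n), (-1 : ℝ) ^ (k / 2) * (m : ℝ) ^ Nat.gcd (4 * n) k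
        - n * m ^ (2 * n + 2) + n * m ^ (2 * n)) ∧
    (∀ h ∈ CdagEven n,
      (dimClass n V (rhoChar n h) : ℝ) = 1 / (2 * n) *
        ∑ k ∈ Finset.range (4 * n),
          (m : ℝ) ^ Nat.gcd (4 * n) k * Real.cos (h * k * Real.pi / (2 * n))) ∧
    (∀ h ∈ Codd23 n \ {n, 3 * n},
      (dimClass n V (rhoChar n h) : ℝ) = 1 / (4 * n) *
        (2 * m ^ (4 * n) - 2 * m ^ (2 * n)
          + 4 * ∑ k ∈ CdagEven n,
            (m : ℝ) ^ Nat.gcd (4 * n) k * Real.cos (h * k * Real.pi / (2 * n)))) :=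
  theorem2p10_general n hn V m hm
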